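/- Let $V$ be a finite-dimensional real normed space. Let $S_V$ be its Steinitz constant: the smallest number such that for all $n\ge 1$ and all $v_1,\dots,v_n\in V$ with $\sum_{i=1}^n v_i=0$ there is a permutation $\pi$ of $\{1,\dots,n\}$ with $\bigl\|\sum_{i=1}^k v_{\pi(i)}\bigr\|\le S_V\max_{1\le i\le n}\|v_i\|$ for all $k=1,\dots,n$. Put $C_V=\frac{8(\dim V)^2}{\log 1.5}(S_V+1)$, where $\log$ is the natural logarithm. Let $q\ge 1$ be an integer and $r>0$ a real number, and let $\mathcal C(q,r)=\{1,\dots,q\}\times\{1,2\}^{\mathbb N}$ carry the product topology of the discrete topologies and the product measure $\mu=\mu_1\times\mu_2^{\mathbb N}$, where $\mu_1(\{i\})=r/q$ for $i=1,\dots,q$ and $\mu_2(\{1\})=\mu_2(\{2\})=\frac12$. For $i=1,\dots,q$ write $\mathcal C(q,r,i)=\{i\}\times\{1,2\}^{\mathbb N}$. Let $f:\mathcal C(q,r)\to V$ be continuous, $f\ne 0$, with $\int f\,d\mu=0$. Write $\|\cdot\|$ also for the supremum norm on continuous functions $\mathcal C(q,r)\to V$, and set $$a=\frac{\max_{1\le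 i\le q}\operatorname{diam} f(\mathcal C(q,r,i))}{\|f\|}.$$ Then there exist a continuous function $g:\mathcal C(q,r)\to V$ with $$\|g\|\le (S_V+a(1+C_V))\|f\|$$ and a $\mu$-preserving homeomorphism $T$ of $\mathcal C(q,r)$ onto itself such that $f=g\circ T-g$ everywhere on $\mathcal C(q,r)$. Furthermore, for these $g$ and $T$, the sets $\mathcal C(q,r,1),\dots,\mathcal C(q,r,q)$ can be labelled $X_1,\dots,X_q$ (each occurring exactly once) so that $T(X_i)=X_{i+1}$ for $i<q$, $T(X_q)=X_1$, and $\|g(x)\|\le (1+C_V)\,a\,\|f\|$ for all $x\in X_1$. -/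

import Mathlib

open MeasureTheory

/-- The set of admissible constants for Steinitz's rearrangement lemma in `V`: those `K` such that
every finite family `v` of vectors with sum zero can be reordered so that all its partial sums have
norm at most `K * max_i ‖v i‖`. (The norm of `v : Fin n → V` is the maximum of the norms `‖v i‖`.) -/
def steinitzSet (V : Type*) [NormedAddCommGroup V] : Set ℝ :=
  {K : ℝ | ∀ (n : ℕ) (v : Fin n → V), ∑ i, v i = 0 →
    ∃ π : Equiv.Perm (Fin n), ∀ k : ℕ, 1 ≤ k → k ≤ n →
      ‖∑ i : Fin n with i.val < k, v (π i)‖ ≤ K * ‖v‖}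

/-- The Steinitz constant `S_V`, the smallest admissible constant. -/
noncomputable def steinitzConst (V : Type*) [NormedAddCommGroup V] : ℝ :=
  sInf (steinitzSet V)

/-- `C_V = (8 (dim V)² / log 1.5) (S_V + 1)`. -/
noncomputable def kwapienConst (V : Type*) [NormedAddCommGroup V] [NormedSpace ℝ V] : ℝ :=
  8 * (Module.finrank ℝ V : ℝ) ^ 2 / Real.log 1.5 * (steinitzConst V + 1)

/-- The Cantor-type space `{1, …, q} × {1, 2}^ℕ`, with the product of the discrete topologies and
the product σ-algebra. -/
abbrev CantorSpace (q : ℕ) : Type := Fin q × (ℕ → Fin 2)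

/-- The measure on the two-point set giving each point mass `1/2`. -/
noncomputable def coinMeasure : Measure (Fin 2) := (2 : ENNReal)⁻¹ • Measure.count

instance coinMeasure_isProbabilityMeasure : IsProbabilityMeasure coinMeasure := by
  constructor
  rw [coinMeasure, Measure.smul_apply, Measure.count_univ]
  simp [ENNReal.inv_mul_cancel]

/-- The product measure on `{1, …, q} × {1, 2}^ℕ`, where each point of `{1, …, q}` has mass `r / q`
and each point of every factor `{1, 2}` has mass `1 / 2`. -/
noncomputable def cantorMeasure (q : ℕ) (r : ℝ) : Measure (CantorSpace q) :=
  (ENNReal.ofReal (r / q) • (Measure.count : Measure (Fin q))).prod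
    (Measure.infinitePi fun _ : ℕ => coinMeasure)

/-- The first-level cylinder `{i} × {1, 2}^ℕ`. -/
def firstCylinder (q : ℕ) (i : Fin q) : Set (CantorSpace q) := {x | x.1 = i}

/-- The relative maximal oscillation `max_i diam (f (C_i)) / ‖f‖` on the first-level cylinders
`C_i`. -/
noncomputable def relOscillation {V : Type*} [NormedAddCommGroup V] {q : ℕ}
    (f : C(CantorSpace q, V)) : ℝ :=
  (⨆ i : Fin q, Metric.diam (f '' firstCylinder q i)) / ‖f‖

/-!
`f` is approximated by its averages over the cylinders of levels `N 0 = 0 < N 1 < ⋯`, chosen such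
that the oscillation of `f` on cylinders is at least halved from each level to the next. On the
cylinders of level `N m` a cyclic permutation `τ m` is given by an enumeration `E m` of these
cylinders; the prefix sums of the averages along `E m` are a step function `g' m` with
`g' m ∘ τ m - g' m` equal to the average of `f`. If each `τ (m + 1)` lies over `τ m`, the `τ m` have
an inverse limit `T`, a homeomorphism which preserves the measure because it permutes the cylinders
of each level `N m`. If also `g' (m + 1) - g' m` is bounded by a multiple of the oscillation of `f`
at level `N m`, then `g' m` converges uniformly to a continuous `g`, and `f = g ∘ T - g`.

At level `0` the enumeration is a Steinitz ordering of the averages over the first-level cylinders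
(`exists_enum_zero`), which gives the term `S_V * ‖f‖`. To refine an enumeration
(`exists_enum_refine`), regard the subcylinders of the `i`th cylinder as row `i` of a matrix of
vectors: the differences between the finer and the coarser averages, with zero sum in each
row. Running through the finer cylinders along the coarser cycle means reading the matrix column
by column, after a permutation of each row. By `exists_perm_rows` the rows can be permuted so that
all partial sums within a column are at most `2 * dim V` times the oscillation, and by Steinitz'
lemma the columns can be ordered so that the sums over the first columns stay bounded as well
(`exists_row_orders`). The resulting geometric series has sum
`(S_V + 1) * 4 * dim V * max_i diam f(C_i)`, which `C_V * max_i diam f(C_i)` dominates.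

Both combinatorial tools rest on the prefix sign lemma `exists_signs_prefix_le`: rows are permuted
by repeated halving along signs, and the signs also prove Steinitz' lemma, by
`exists_perm_prefix_le_half`. Steinitz' lemma is needed for the infimum `steinitzConst V` to be
meaningful: it shows that `steinitzSet V` is nonempty, so that the infimum is attained.
-/

/-! ### Signs with small prefix sums -/

/-- Sliding a coefficient vector in `[-1, 1]^s` along linear relations between the vectors `u i`
until at most `dim V` coefficients differ from `±1`; the sum `∑ x i • u i` and the coefficients
which are already `±1` do not change. -/
theorem exists_few_floating {ι V : Type*} [AddCommGroup V] [Module ℝ V]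
    [FiniteDimensional ℝ V] (s : Finset ι) (u : ι → V) (x : ι → ℝ) (hx : ∀ i, |x i| ≤ 1) :
    ∃ y : ι → ℝ, (∀ i, |y i| ≤ 1) ∧ ∑ i ∈ s, y i • u i = ∑ i ∈ s, x i • u i ∧
      (∀ i, |x i| = 1 → y i = x i) ∧ {i ∈ s | |y i| ≠ 1}.card ≤ Module.finrank ℝ V := by
  classical
  induction h : {i ∈ s | |x i| ≠ 1}.card using Nat.strong_induction_on generalizing x with
  | _ m ih =>
    by_cases hm : m ≤ Module.finrank ℝ V
    · exact ⟨x, hx, rfl, fun _ _ => rfl, h.le.trans hm⟩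
    set A := {i ∈ s | |x i| ≠ 1} with hA
    have hdep : ¬ LinearIndepOn ℝ u (A : Set ι) := fun hli => by
      have := LinearIndependent.fintype_card_le_finrank (b := fun i : (A : Set ι) => u i) hli
      simp only [Finset.coe_sort_coe, Fintype.card_coe] at this
      omega
    obtain ⟨c, hc, i₀, hi₀, hci₀⟩ := not_linearIndepOn_finset_iff.1 hdep
    -- the time at which the coefficient `x i + t * c i` reaches `±1`
    let τ : ι → ℝ := fun i => (1 - x i * SignType.sign (c i)) / |c i|
    obtain ⟨i₁, hi₁, hmin⟩ := Finset.exists_min_image {i ∈ A | c i ≠ 0} τ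
      ⟨i₀, Finset.mem_filter.2 ⟨hi₀, hci₀⟩⟩
    rw [Finset.mem_filter] at hi₁
    have hτ : 0 ≤ τ i₁ := by
      have h1 := abs_le.1 (hx i₁)
      apply div_nonneg _ (abs_nonneg _)
      rcases lt_or_gt_of_ne hi₁.2 with h2 | h2 <;> simp [h2] <;> linarith
    let y : ι → ℝ := fun i => if i ∈ A then x i + τ i₁ * c i else x i
    have hy1 : ∀ i, |y i| ≤ 1 := by
      intro i
      by_cases hi : i ∈ A
      swap
      · simpa [y, hi] using hx i
      simp only [y, hi, if_true]
      have h1 := abs_le.1 (hx i)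
      by_cases hci : c i = 0
      · simpa [hci] using hx i
      have h2 := hmin i (Finset.mem_filter.2 ⟨hi, hci⟩)
      rw [show τ i = (1 - x i * SignType.sign (c i)) / |c i| from rfl,
        le_div_iff₀ (abs_pos.2 hci)] at h2
      rw [abs_le]
      rcases lt_or_gt_of_ne hci with h3 | h3
      · simp only [h3, abs_of_neg, sign_neg, SignType.coe_neg, SignType.coe_one] at h2
        constructor <;> nlinarith
      · simp only [h3, abs_of_pos, sign_pos, SignType.coe_one] at h2
        constructor <;> nlinarith
    have hfix : ∀ i, |x i| = 1 → y i = x i := by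
      intro i hi
      have : i ∉ A := by simp [hA, hi]
      simp [y, this]
    have hy₁ : |y i₁| = 1 := by
      have h1 : |c i₁| ≠ 0 := abs_ne_zero.2 hi₁.2
      simp only [y, hi₁.1, if_true, τ]
      rcases lt_or_gt_of_ne hi₁.2 with h3 | h3
      · have : x i₁ + (1 - x i₁ * (SignType.sign (c i₁) : ℝ)) / |c i₁| * c i₁ = -1 := by
          simp only [h3, abs_of_neg, sign_neg, SignType.coe_neg, SignType.coe_one]
          have := h3.ne
          field_simp
          ring
        rw [this]; simp
      · have : x i₁ + (1 - x i₁ * (SignType.sign (c i₁) : ℝ)) / |c i₁| * c i₁ = 1 := by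
          simp only [h3, abs_of_pos, sign_pos, SignType.coe_one]
          have := h3.ne'
          field_simp
          ring
        rw [this]; simp
    have hsum : ∑ i ∈ s, y i • u i = ∑ i ∈ s, x i • u i := by
      have h1 : ∀ i ∈ s, y i • u i = x i • u i + if i ∈ A then τ i₁ • (c i • u i) else 0 := by
        intro i _
        by_cases hi : i ∈ A
        · simp [y, hi, add_smul, mul_smul]
        · simp [y, hi]
      rw [Finset.sum_congr rfl h1, Finset.sum_add_distrib, ← Finset.sum_filter,
        Finset.filter_mem_eq_inter, Finset.inter_eq_right.2 (Finset.filter_subset _ _),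
        ← Finset.smul_sum, hc, smul_zero, add_zero]
    have hlt : {i ∈ s | |y i| ≠ 1}.card < m := by
      rw [← h]
      apply Finset.card_lt_card
      refine ⟨fun i hi => ?_, fun hsub => ?_⟩
      · rw [Finset.mem_filter] at hi
        refine Finset.mem_filter.2 ⟨hi.1, fun h1 => hi.2 ?_⟩
        rw [hfix i h1, h1]
      · exact (Finset.mem_filter.1 (hsub hi₁.1)).2 hy₁
    obtain ⟨z, hz1, hz2, hz3, hz4⟩ := ih _ hlt y hy1 rfl
    exact ⟨z, hz1, hz2.trans hsum, fun i hi => (hz3 i (by rw [hfix i hi, hi])).trans (hfix i hi),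
      hz4⟩

/-- **Signed prefix sums.** Vectors of norm at most `D` can be given signs such that all prefix sums
have norm at most `2 * dim V * D` (the argument of Bárány and Grinberg). -/
theorem exists_signs_prefix_le {V : Type*} [NormedAddCommGroup V] [NormedSpace ℝ V]
    [FiniteDimensional ℝ V] (u : ℕ → V) {D : ℝ} (hu : ∀ i, ‖u i‖ ≤ D) (n : ℕ) :
    ∃ ε : ℕ → Bool, ∀ k ≤ n,
      ‖∑ i ∈ Finset.range k, (if ε i then (1 : ℝ) else -1) • u i‖
        ≤ 2 * Module.finrank ℝ V * D := by
  classical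
  have hD : 0 ≤ D := (norm_nonneg _).trans (hu 0)
  -- Coefficients `x` with few floating entries and zero sum; any rounding `e` of `x` is good.
  have key : ∀ n, ∃ x : ℕ → ℝ, (∀ i, |x i| ≤ 1) ∧ ∑ i ∈ Finset.range n, x i • u i = 0 ∧
      {i ∈ Finset.range n | |x i| ≠ 1}.card ≤ Module.finrank ℝ V ∧
      ∀ e : ℕ → ℝ, (∀ i, |e i| = 1) → (∀ i < n, |x i| = 1 → e i = x i) → ∀ k ≤ n,
        ‖∑ i ∈ Finset.range k, e i • u i‖ ≤ 2 * Module.finrank ℝ V * D := by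
    intro n
    induction n with
    | zero =>
      refine ⟨0, by simp, by simp, by simp, fun e _ _ k hk => ?_⟩
      obtain rfl : k = 0 := by omega
      simp only [Finset.range_zero, Finset.sum_empty, norm_zero]
      positivity
    | succ n ih =>
      obtain ⟨x, hx1, hx2, -, hx4⟩ := ih
      have hx' : ∀ i, |Function.update x n 0 i| ≤ 1 := by
        intro i
        by_cases hi : i = n
        · subst hi; simp
        · simpa [hi] using hx1 i
      have hne : ∀ i < n, Function.update x n 0 i = x i := fun i hi =>
        Function.update_of_ne hi.ne _ _
      obtain ⟨y, hy1, hy2, hy3, hy4⟩ :=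
        exists_few_floating (Finset.range (n + 1)) u (Function.update x n 0) hx'
      have hy0 : ∑ i ∈ Finset.range (n + 1), y i • u i = 0 := by
        rw [hy2, Finset.sum_range_succ, Function.update_self, zero_smul, add_zero, ← hx2]
        refine Finset.sum_congr rfl fun i hi => ?_
        rw [hne i (Finset.mem_range.1 hi)]
      refine ⟨y, hy1, hy0, hy4, fun e he hey k hk => ?_⟩
      rcases hk.lt_or_eq with hk | rfl
      · refine hx4 e he (fun i hi h1 => ?_) k (by omega)
        have h2 : y i = x i := by rw [← hne i hi]; exact hy3 i (by rw [hne i hi, h1])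
        rw [← h2]
        exact hey i (by omega) (by rw [h2, h1])
      · have h1 : ∑ i ∈ Finset.range (n + 1), e i • u i =
            ∑ i ∈ Finset.range (n + 1) with |y i| ≠ 1, (e i - y i) • u i := by
          have h0 : ∑ i ∈ Finset.range (n + 1), e i • u i =
              ∑ i ∈ Finset.range (n + 1), e i • u i - ∑ i ∈ Finset.range (n + 1), y i • u i := by
            rw [hy0, sub_zero]
          rw [h0, Finset.sum_filter, ← Finset.sum_sub_distrib]
          refine Finset.sum_congr rfl fun i hi => ?_
          rw [← sub_smul]
          split_ifs with h
          · rfl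
          · rw [hey i (Finset.mem_range.1 hi) (not_not.1 h), sub_self, zero_smul]
        rw [h1]
        calc _ ≤ ∑ i ∈ Finset.range (n + 1) with |y i| ≠ 1, 2 * D := by
              refine norm_sum_le_of_le _ fun i _ => ?_
              rw [norm_smul, Real.norm_eq_abs]
              have : |e i - y i| ≤ 2 := (abs_sub _ _).trans (by linarith [he i, hy1 i])
              exact mul_le_mul this (hu i) (norm_nonneg _) (by norm_num)
          _ ≤ _ := by
              rw [Finset.sum_const, nsmul_eq_mul]
              have : (({i ∈ Finset.range (n + 1) | |y i| ≠ 1}.card : ℕ) : ℝ)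
                ≤ Module.finrank ℝ V := by exact_mod_cast hy4
              nlinarith
  obtain ⟨x, -, -, -, hx⟩ := key n
  refine ⟨fun i => decide (x i = 1), fun k hk => ?_⟩
  refine hx (fun i => if decide (x i = 1) then 1 else -1) (fun i => ?_) (fun i _ hi => ?_) k hk
  · split_ifs <;> simp
  · rcases eq_or_eq_neg_of_abs_eq hi with h | h
    · simp [h]
    · rw [h]; norm_num

/-! ### The Steinitz constant -/

theorem sum_fin_filter_val_lt {M : Type*} [AddCommMonoid M] {n k : ℕ} (hk : k ≤ n) (u : ℕ → M) :
    ∑ i : Fin n with i.val < k, u i = ∑ i ∈ Finset.range k, u i := by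
  refine Finset.sum_nbij (fun i : Fin n => i.val) (by simp) ?_ ?_ (by simp)
  · exact fun a _ b _ h => Fin.ext h
  · intro i hi
    have : i < k := by simpa using hi
    exact ⟨⟨i, by omega⟩, by simpa using this, rfl⟩

/-- **Chobanyan's rearrangement step.** If the prefix sums of a zero-sum list are bounded by `M` and
its signed prefix sums by `B`, then listing the terms with positive sign in their order, followed by
the terms with negative sign in the reverse order, bounds the prefix sums by `(M + B) / 2`. -/
theorem exists_perm_prefix_le_half {ι V : Type*} [NormedAddCommGroup V] [NormedSpace ℝ V]
    [FiniteDimensional ℝ V] (v : ι → V) {D : ℝ} (hv : ∀ i, ‖v i‖ ≤ D) (hD : 0 ≤ D) (l : List ι)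
    (hl : (l.map v).sum = 0) {M : ℝ} (hM : ∀ p, p <+: l → ‖(p.map v).sum‖ ≤ M) :
    ∃ l' : List ι, l'.Perm l ∧ ∀ p, p <+: l' →
      ‖(p.map v).sum‖ ≤ (M + 2 * Module.finrank ℝ V * D) / 2 := by
  let u : ℕ → V := fun i => if h : i < l.length then v l[i] else 0
  have hu : ∀ i, ‖u i‖ ≤ D := by
    intro i
    by_cases h : i < l.length <;> simp [u, h, hv, hD]
  obtain ⟨ε, hε⟩ := exists_signs_prefix_le u hu l.length
  let sg : ι × Bool → V := fun z => (if z.2 then (1 : ℝ) else -1) • v z.1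
  let z : List (ι × Bool) := List.ofFn fun i : Fin l.length => (l[i], ε i)
  have hzl : z.map Prod.fst = l := by
    simp only [z, List.map_ofFn]
    exact List.ofFn_getElem
  have hz : ∀ p, p <+: z → ‖(p.map sg).sum‖ ≤ 2 * Module.finrank ℝ V * D := by
    intro p hp
    have hk : p.length ≤ l.length := by simpa [z] using hp.length_le
    rw [List.prefix_iff_eq_take.1 hp, List.map_take, List.map_ofFn, List.sum_take_ofFn]
    refine le_of_eq_of_le ?_ (hε _ hk)
    rw [← sum_fin_filter_val_lt hk]
    congr 1
    refine Finset.sum_congr rfl fun i _ => ?_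
    simp [sg, u]
  -- The terms with a given sign sum up to half of the full sum plus or minus the signed sum.
  have hsgn : ∀ p : List (ι × Bool),
      ((p.filter Prod.snd).map fun a => v a.1).sum =
        (2⁻¹ : ℝ) • ((p.map fun a => v a.1).sum + (p.map sg).sum) ∧
      ((p.filter fun a => !a.2).map fun a => v a.1).sum =
        (2⁻¹ : ℝ) • ((p.map fun a => v a.1).sum - (p.map sg).sum) := by
    intro p
    induction p with
    | nil => simp
    | cons a p ih =>
      obtain ⟨a, b⟩ := a
      cases b
      · simp only [sg, List.filter_cons, List.map_cons, List.sum_cons] at ih ⊢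
        simp only [Bool.false_eq_true, if_false, Bool.not_false, if_true, List.map_cons,
          List.sum_cons, ih.1, ih.2]
        constructor <;> module
      · simp only [sg, List.filter_cons, List.map_cons, List.sum_cons] at ih ⊢
        simp only [Bool.false_eq_true, if_false, Bool.not_true, if_true, List.map_cons,
          List.sum_cons, ih.1, ih.2]
        constructor <;> module
  have hpre : ∀ p, p <+: z →
      ‖(p.map fun a => v a.1).sum‖ ≤ M := by
    intro p hp
    have := hM (p.map Prod.fst) (hzl ▸ hp.map Prod.fst)
    simpa [List.map_map, Function.comp_def] using this
  have hpos : ∀ p, p <+: z.filter Prod.snd →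
      ‖(p.map fun a => v a.1).sum‖ ≤ (M + 2 * Module.finrank ℝ V * D) / 2 := by
    intro p hp
    obtain ⟨p', hp', rfl⟩ := List.prefix_filter_iff.1 hp
    rw [(hsgn p').1, norm_smul]
    have := norm_add_le (p'.map fun a => v a.1).sum (p'.map sg).sum
    have := hpre p' hp'
    have := hz p' hp'
    norm_num
    linarith
  have hneg : ∀ p, p <+: z.filter (fun a => !a.2) →
      ‖(p.map fun a => v a.1).sum‖ ≤ (M + 2 * Module.finrank ℝ V * D) / 2 := by
    intro p hp
    obtain ⟨p', hp', rfl⟩ := List.prefix_filter_iff.1 hp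
    rw [(hsgn p').2, norm_smul]
    have := norm_sub_le (p'.map fun a => v a.1).sum (p'.map sg).sum
    have := hpre p' hp'
    have := hz p' hp'
    norm_num
    linarith
  let w := z.filter Prod.snd ++ (z.filter fun a => !a.2).reverse
  have hw : w.Perm z :=
    ((List.reverse_perm _).append_left _).trans (List.filter_append_perm Prod.snd z)
  refine ⟨w.map Prod.fst, hzl ▸ hw.map Prod.fst, fun p hp' => ?_⟩
  obtain ⟨p, hp, rfl⟩ : ∃ p', p' <+: w ∧ p = p'.map Prod.fst :=
    ⟨w.take p.length, List.take_prefix _ _, by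
      rw [List.map_take]; exact List.prefix_iff_eq_take.1 hp'⟩
  rw [List.map_map]
  change ‖(p.map fun a => v a.1).sum‖ ≤ _
  rcases List.prefix_or_prefix_of_prefix hp (List.prefix_append _ _) with h | ⟨t, rfl⟩
  · exact hpos p h
  · -- The rest of the list is the reverse of a prefix of the negative terms.
    obtain ⟨t', ht'⟩ := (List.prefix_append_right_inj _).1 hp
    have hpt : t'.reverse <+: z.filter (fun a => !a.2) :=
      ⟨t.reverse, by rw [← List.reverse_append, ht', List.reverse_reverse]⟩
    have h0 : (w.map fun a => v a.1).sum = 0 := by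
      rw [(hw.map _).sum_eq, ← hl, ← hzl, List.map_map]; rfl
    have h1 : w = (z.filter Prod.snd ++ t) ++ t' := by rw [List.append_assoc, ht']
    rw [h1, List.map_append, List.sum_append] at h0
    rw [eq_neg_of_add_eq_zero_left h0, norm_neg, ← (((List.reverse_perm t').map _).sum_eq)]
    exact hneg _ hpt

/-- **Steinitz' lemma**, with the constant `2 * dim V + 1`. -/
theorem steinitzSet_nonempty (V : Type*) [NormedAddCommGroup V] [NormedSpace ℝ V]
    [FiniteDimensional ℝ V] : (steinitzSet V).Nonempty := by
  refine ⟨2 * Module.finrank ℝ V + 1, fun n v hv => ?_⟩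
  set B : ℝ := 2 * Module.finrank ℝ V * ‖v‖ with hB
  -- Repeating the rearrangement step, the excess over `B` is halved every time.
  have key : ∀ k : ℕ, ∃ l : List (Fin n), l.Perm (List.finRange n) ∧
      ∀ p, p <+: l → ‖(p.map v).sum‖ ≤ B + n * ‖v‖ / 2 ^ k := by
    intro k
    induction k with
    | zero =>
      refine ⟨_, List.Perm.refl _, fun p hp => ?_⟩
      have h1 : ∀ p : List (Fin n), ‖(p.map v).sum‖ ≤ p.length * ‖v‖ := by
        intro p
        induction p with
        | nil => simp
        | cons a p ih =>
          simp only [List.map_cons, List.sum_cons, List.length_cons, Nat.cast_succ]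
          linarith [norm_add_le (v a) (p.map v).sum, norm_le_pi_norm v a]
      have h2 : p.length ≤ n := by simpa using hp.length_le
      have h3 : (p.length : ℝ) * ‖v‖ ≤ n * ‖v‖ := by gcongr
      have h4 : 0 ≤ B := by positivity
      simp only [pow_zero, div_one]
      linarith [h1 p]
    | succ k ih =>
      obtain ⟨l, hl, hl'⟩ := ih
      have h0 : (l.map v).sum = 0 := by
        rw [(hl.map v).sum_eq, ← hv, ← List.ofFn_eq_map, List.sum_ofFn]
      obtain ⟨l', hp, hl''⟩ :=
        exists_perm_prefix_le_half v (fun i => norm_le_pi_norm v i) (norm_nonneg _) l h0 hl'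
      refine ⟨l', hp.trans hl, fun p hp => (hl'' p hp).trans (le_of_eq ?_)⟩
      rw [← hB, pow_succ]
      field_simp
      ring
  obtain ⟨l, hl, hl'⟩ := key n
  have hlen : l.length = n := by simpa using hl.length_eq
  have hnd : l.Nodup := hl.nodup_iff.2 (List.nodup_finRange n)
  let π : Equiv.Perm (Fin n) := (finCongr hlen.symm).trans
    (hnd.getEquivOfForallMemList l fun x => hl.mem_iff.2 (List.mem_finRange x))
  refine ⟨π, fun k _ hk => ?_⟩
  have h1 : l.map v = List.ofFn fun i => v (π i) := by
    apply List.ext_getElem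
    · simp [hlen]
    · intro i h1 h2
      simp [π]
  have h2 : ‖((l.take k).map v).sum‖ ≤ B + n * ‖v‖ / 2 ^ n := hl' _ (List.take_prefix _ _)
  rw [List.map_take, h1, List.sum_take_ofFn] at h2
  refine h2.trans ?_
  have h3 : (n : ℝ) ≤ 2 ^ n := by exact_mod_cast (Nat.lt_two_pow_self (n := n)).le
  have h4 : n * ‖v‖ / 2 ^ n ≤ ‖v‖ := by
    rw [div_le_iff₀ (by positivity), mul_comm]
    gcongr
  linarith

theorem one_le_of_mem_steinitzSet {V : Type*} [NormedAddCommGroup V] [Nontrivial V] {K : ℝ}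
    (hK : K ∈ steinitzSet V) : 1 ≤ K := by
  obtain ⟨x, hx⟩ := exists_ne (0 : V)
  obtain ⟨π, hπ⟩ := hK 2 ![x, -x] (by simp)
  have h := hπ 1 le_rfl (by norm_num)
  have h1 : ‖(![x, -x] : Fin 2 → V)‖ = ‖x‖ := by
    apply le_antisymm
    · rw [pi_norm_le_iff_of_nonneg (norm_nonneg _)]
      intro i; fin_cases i <;> simp
    · exact norm_le_pi_norm (![x, -x] : Fin 2 → V) 0
  have h2 : (Finset.univ.filter fun i : Fin 2 => i.val < 1) = {0} := by decide
  rw [h1, h2, Finset.sum_singleton] at h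
  have h3 : ‖(![x, -x] : Fin 2 → V) (π 0)‖ = ‖x‖ := by
    generalize π 0 = i
    fin_cases i <;> simp
  rw [h3] at h
  have : 0 < ‖x‖ := norm_pos_iff.2 hx
  nlinarith

theorem isClosed_steinitzSet (V : Type*) [NormedAddCommGroup V] : IsClosed (steinitzSet V) := by
  simp only [steinitzSet, Set.ofPred_forall, Set.ofPred_exists]
  refine isClosed_iInter fun n => isClosed_iInter fun v => isClosed_iInter fun _ =>
    isClosed_iUnion_of_finite fun π => isClosed_iInter fun k => isClosed_iInter fun _ =>
    isClosed_iInter fun _ => ?_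
  exact isClosed_le continuous_const (by fun_prop)

/-- The infimum defining the Steinitz constant is attained. -/
theorem steinitzConst_mem (V : Type*) [NormedAddCommGroup V] [NormedSpace ℝ V]
    [FiniteDimensional ℝ V] [Nontrivial V] : steinitzConst V ∈ steinitzSet V :=
  (isClosed_steinitzSet V).csInf_mem (steinitzSet_nonempty V)
    ⟨1, fun _ h => one_le_of_mem_steinitzSet h⟩

/-- Steinitz' lemma for a sequence of which only the first `n` terms matter. -/
theorem exists_perm_prefix_le {V : Type*} [NormedAddCommGroup V] [NormedSpace ℝ V]
    [FiniteDimensional ℝ V] [Nontrivial V] {n : ℕ} (v : Fin n → V) (hv : ∑ i, v i = 0)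
    {D : ℝ} (hD : 0 ≤ D) (hvD : ∀ i, ‖v i‖ ≤ D) :
    ∃ π : Equiv.Perm (Fin n), ∀ k ≤ n, ∀ u : ℕ → V, (∀ i : Fin n, u i = v (π i)) →
      ‖∑ i ∈ Finset.range k, u i‖ ≤ steinitzConst V * D := by
  have hS := one_le_of_mem_steinitzSet (steinitzConst_mem V)
  obtain ⟨π, hπ⟩ := steinitzConst_mem V n v hv
  refine ⟨π, fun k hk u hu => ?_⟩
  rcases Nat.eq_zero_or_pos k with rfl | hk0
  · simp only [Finset.range_zero, Finset.sum_empty, norm_zero]; positivity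
  rw [← sum_fin_filter_val_lt hk]
  simp only [hu]
  refine (hπ k hk0 hk).trans ?_
  have : ‖v‖ ≤ D := (pi_norm_le_iff_of_nonneg hD).2 hvD
  gcongr

/-! ### Arranging rows of vectors into balanced columns -/

theorem sum_range_mul_eq {M : Type*} [AddCommMonoid M] (f : ℕ → M) (j m : ℕ) :
    ∑ n ∈ Finset.range (j * m), f n =
      ∑ i ∈ Finset.range j, ∑ b ∈ Finset.range m, f (i * m + b) := by
  induction j with
  | zero => simp
  | succ j ih => rw [Nat.succ_mul, Finset.sum_range_add, ih, Finset.sum_range_succ]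

/-- Rows of `2 ^ k` vectors which oscillate by at most `D` in each row can be permuted row by row so
that in every column each partial sum of the first rows differs from the partial sum of the row
averages by at most `2 * dim V * D`. The rows are halved recursively: pair the entries
of each row, and let the signs of `exists_signs_prefix_le`, applied to the differences within the
pairs, decide which half each entry goes to. The averages of the halves of rows of length `2 ^ k`
then deviate by at most `2 * dim V * D / 2 ^ k`. -/
theorem exists_perm_rows {V : Type*} [NormedAddCommGroup V] [NormedSpace ℝ V]
    [FiniteDimensional ℝ V] {D : ℝ} (L k : ℕ) {β : Type} [Fintype β]
    (hβ : Fintype.card β = 2 ^ k) (w : ℕ → β → V) (hw : ∀ i b b', ‖w i b - w i b'‖ ≤ D) :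
    ∃ σ : ℕ → Equiv.Perm β, ∀ b, ∀ j ≤ L,
      ‖∑ i ∈ Finset.range j, (w i (σ i b) - ((2 : ℝ) ^ k)⁻¹ • ∑ b, w i b)‖
        ≤ 2 * Module.finrank ℝ V * D * (1 - ((2 : ℝ) ^ k)⁻¹) := by
  induction k generalizing β with
  | zero =>
    refine ⟨fun _ => Equiv.refl β, fun b j _ => ?_⟩
    have : Subsingleton β := Fintype.card_le_one_iff_subsingleton.1 (by simp [hβ])
    have : Unique β := uniqueOfSubsingleton b
    simp [Subsingleton.elim b default]
  | succ k ih =>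
    set d : ℝ := (Module.finrank ℝ V : ℝ)
    set m := 2 ^ k with hm
    have hm0 : 0 < m := by positivity
    let e : Bool × Fin m ≃ β := Fintype.equivOfCardEq (by simp [hβ, hm, pow_succ, mul_comm])
    let u : ℕ → V := fun n =>
      w (n / m) (e (true, ⟨n % m, Nat.mod_lt _ hm0⟩)) -
        w (n / m) (e (false, ⟨n % m, Nat.mod_lt _ hm0⟩))
    have hu_add : ∀ i (b : Fin m), u (i * m + b) = w i (e (true, b)) - w i (e (false, b)) := by
      intro i b
      have h1 : (i * m + b) / m = i := by
        rw [mul_comm, Nat.mul_add_div hm0, Nat.div_eq_of_lt b.2, add_zero]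
      have h2 : (i * m + (b : ℕ)) % m = b := by
        rw [mul_comm, Nat.mul_add_mod, Nat.mod_eq_of_lt b.2]
      simp only [u, h1, h2]
    obtain ⟨ε, hε⟩ := exists_signs_prefix_le u (D := D) (fun n => hw _ _ _) (L * m)
    let δ : ℕ → Fin m → Bool := fun i b => ε (i * m + b)
    -- The two halves of the rows, labelled by `Bool`.
    let W : Bool → ℕ → Fin m → V := fun s i b => w i (e (s == δ i b, b))
    choose σ hσ using fun s => ih (β := Fin m) (by simp [hm]) (W s) (fun i b b' => hw _ _ _)
    have hbij : ∀ i, Function.Bijective fun x : Bool × Fin m =>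
        ((x.1 == δ i (σ x.1 i x.2), σ x.1 i x.2) : Bool × Fin m) := by
      intro i
      rw [← Finite.injective_iff_bijective]
      rintro ⟨s, b⟩ ⟨s', b'⟩ h
      simp only [Prod.mk.injEq] at h
      obtain ⟨h1, h2⟩ := h
      rw [h2] at h1
      have h3 : s = s' := by
        revert h1
        cases s <;> cases s' <;> cases δ i (σ _ i b') <;> simp
      subst h3
      rw [(σ s i).injective h2]
    refine ⟨fun i => (e.symm.trans (Equiv.ofBijective _ (hbij i))).trans e, fun x j hj => ?_⟩
    obtain ⟨⟨s, b⟩, rfl⟩ := e.surjective x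
    have hdiff : ∀ i, ((2 : ℝ) ^ k)⁻¹ • ∑ b, W s i b - ((2 : ℝ) ^ (k + 1))⁻¹ • ∑ x, w i x =
        (if s then (1 : ℝ) else -1) • ((2 : ℝ) ^ (k + 1))⁻¹ •
          ∑ b ∈ Finset.range m, (if ε (i * m + b) then (1 : ℝ) else -1) • u (i * m + b) := by
      intro i
      rw [← e.sum_comp, Fintype.sum_prod_type, Fintype.sum_bool, ← Finset.sum_add_distrib,
        Finset.sum_range, pow_succ, mul_inv, mul_smul, mul_smul, smul_comm _ (_ ^ k)⁻¹,
        ← smul_sub]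
      congr 1
      simp only [Finset.smul_sum]
      rw [← Finset.sum_sub_distrib]
      refine Finset.sum_congr rfl fun b _ => ?_
      rw [hu_add]
      simp only [W, δ]
      cases s <;> cases ε (i * m + b) <;> simp <;> module
    have hsplit : ∀ i, w i (e (s == δ i (σ s i b), σ s i b)) -
        ((2 : ℝ) ^ (k + 1))⁻¹ • ∑ x, w i x =
        (W s i (σ s i b) - ((2 : ℝ) ^ k)⁻¹ • ∑ b, W s i b) +
        (if s then (1 : ℝ) else -1) • ((2 : ℝ) ^ (k + 1))⁻¹ •
          ∑ b ∈ Finset.range m, (if ε (i * m + b) then (1 : ℝ) else -1) • u (i * m + b) := by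
      intro i
      rw [← hdiff, sub_add_sub_cancel]
    simp only [Equiv.trans_apply, Equiv.symm_apply_apply, Equiv.ofBijective_apply, hsplit]
    rw [Finset.sum_add_distrib, ← Finset.smul_sum, ← Finset.smul_sum, ← sum_range_mul_eq
      (fun n => (if ε n then (1 : ℝ) else -1) • u n)]
    refine (norm_add_le _ _).trans ((add_le_add (hσ s b j hj)
      (?_ : _ ≤ 2 * d * D * ((2 : ℝ) ^ (k + 1))⁻¹)).trans (le_of_eq ?_))
    · have h1 : ‖(if s then (1 : ℝ) else -1)‖ = 1 := by cases s <;> simp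
      rw [norm_smul, norm_smul, h1, one_mul, mul_comm, Real.norm_of_nonneg (by positivity)]
      gcongr
      exact hε _ (Nat.mul_le_mul_right _ hj)
    · rw [pow_succ]; field_simp; ring

/-- Rows of `2 ^ k` vectors with zero sum which oscillate by at most `D` in each row can be permuted
row by row so that all partial sums are bounded when the first `L` rows are read column after
column. The columns are balanced by `exists_perm_rows` and then ordered by Steinitz' lemma. -/
theorem exists_row_orders {V : Type*} [NormedAddCommGroup V] [NormedSpace ℝ V]
    [FiniteDimensional ℝ V] [Nontrivial V] {D : ℝ} (hD : 0 ≤ D) {L : ℕ} (hL : 0 < L) (k : ℕ)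
    {β : Type} [Fintype β] (hβ : Fintype.card β = 2 ^ k) (w : ℕ → β → V)
    (hw : ∀ i b b', ‖w i b - w i b'‖ ≤ D) (hw0 : ∀ i, ∑ b, w i b = 0) :
    ∃ σ : ℕ → ℕ → β, (∀ i t t', σ i t = σ i t' ↔ t ≡ t' [MOD 2 ^ k]) ∧
      (∀ i b, ∃ t, σ i t = b) ∧
      ∀ n < L * 2 ^ k, ‖∑ x ∈ Finset.range n, w (x % L) (σ (x % L) (x / L))‖
        ≤ (steinitzConst V + 1) * (2 * Module.finrank ℝ V * D) := by
  set B : ℝ := 2 * Module.finrank ℝ V * D with hB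
  have hB0 : 0 ≤ B := by positivity
  obtain ⟨σ, hσ⟩ := exists_perm_rows L k hβ w hw
  simp only [hw0, smul_zero, sub_zero] at hσ
  have hσB : ∀ b, ∀ j ≤ L, ‖∑ i ∈ Finset.range j, w i (σ i b)‖ ≤ B := fun b j hj =>
    (hσ b j hj).trans (mul_le_of_le_one_right hB0 (by
      have : 0 ≤ ((2 : ℝ) ^ k)⁻¹ := by positivity
      linarith))
  let e : Fin (2 ^ k) ≃ β := Fintype.equivOfCardEq (by simp [hβ])
  obtain ⟨π, hπ⟩ := exists_perm_prefix_le
    (fun t : Fin (2 ^ k) => ∑ i ∈ Finset.range L, w i (σ i (e t)))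
    (by
      rw [Finset.sum_comm]
      refine Finset.sum_eq_zero fun i _ => ?_
      rw [e.sum_comp fun b => w i (σ i b), Equiv.sum_comp (σ i) (w i), hw0]) hB0
    fun t => hσB _ L le_rfl
  have h2 : 0 < 2 ^ k := by positivity
  let τ : ℕ → ℕ → β := fun i t => σ i (e (π ⟨t % 2 ^ k, Nat.mod_lt _ h2⟩))
  refine ⟨τ, fun i t t' => ?_, fun i b => ?_, fun n hn => ?_⟩
  · simp [τ, Nat.ModEq]
  · refine ⟨π.symm (e.symm ((σ i).symm b)), ?_⟩
    have : (π.symm (e.symm ((σ i).symm b)) : ℕ) % 2 ^ k = π.symm (e.symm ((σ i).symm b)) :=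
      Nat.mod_eq_of_lt (Fin.is_lt _)
    simp [τ, this]
  · have ht : n / L < 2 ^ k := Nat.div_lt_of_lt_mul hn
    have hdiv : ∀ t s, s < L → (t * L + s) / L = t := fun t s hs => by
      rw [mul_comm, Nat.mul_add_div hL, Nat.div_eq_of_lt hs, add_zero]
    have hmod : ∀ t s, s < L → (t * L + s) % L = s := fun t s hs => by
      rw [mul_comm, Nat.mul_add_mod, Nat.mod_eq_of_lt hs]
    rw [← Nat.div_add_mod' n L, Finset.sum_range_add, sum_range_mul_eq]
    have h3 : ∑ t ∈ Finset.range (n / L), ∑ s ∈ Finset.range L,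
          w ((t * L + s) % L) (τ ((t * L + s) % L) ((t * L + s) / L)) =
        ∑ t ∈ Finset.range (n / L), ∑ s ∈ Finset.range L, w s (τ s t) := by
      refine Finset.sum_congr rfl fun t _ => Finset.sum_congr rfl fun s hs => ?_
      rw [hdiv t s (Finset.mem_range.1 hs), hmod t s (Finset.mem_range.1 hs)]
    have h4 : ∑ s ∈ Finset.range (n % L),
          w ((n / L * L + s) % L) (τ ((n / L * L + s) % L) ((n / L * L + s) / L)) =
        ∑ s ∈ Finset.range (n % L), w s (τ s (n / L)) := by
      refine Finset.sum_congr rfl fun s hs => ?_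
      have hs' := (Finset.mem_range.1 hs).trans (Nat.mod_lt n hL)
      rw [hdiv _ s hs', hmod _ s hs']
    rw [h3, h4, add_mul, one_mul]
    refine (norm_add_le _ _).trans (add_le_add ?_ ?_)
    · refine hπ (n / L) ht.le (fun t => ∑ s ∈ Finset.range L, w s (τ s t)) fun t => ?_
      have : (t : ℕ) % 2 ^ k = t := Nat.mod_eq_of_lt t.2
      simp [τ, this]
    · exact hσB _ _ (Nat.mod_lt n hL).le

/-! ### Cylinders of the Cantor space -/

/-- The cylinders of level `N`, encoded by the first `N + 1` coordinates. -/
abbrev Cyl (q N : ℕ) : Type := Fin q × (Fin N → Fin 2)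

/-- The cylinder of level `N` containing the point `x`. -/
def trunc {q : ℕ} (N : ℕ) (x : CantorSpace q) : Cyl q N := (x.1, fun i => x.2 i)

/-- The cylinder of level `N` containing the cylinder `c` of the finer level `M`. -/
def Cyl.restrict {q N M : ℕ} (h : N ≤ M) (c : Cyl q M) : Cyl q N :=
  (c.1, fun i => c.2 (Fin.castLE h i))

/-- The subcylinder of `c` with the `k` additional coordinates `b`. -/
def Cyl.extend {q N k : ℕ} (c : Cyl q N) (b : Fin k → Fin 2) : Cyl q (N + k) :=
  (c.1, Fin.append c.2 b)

theorem restrict_trunc {q N M : ℕ} (h : N ≤ M) (x : CantorSpace q) :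
    (trunc M x).restrict h = trunc N x := rfl

theorem restrict_extend {q N k : ℕ} (h : N ≤ N + k) (c : Cyl q N) (b : Fin k → Fin 2) :
    (c.extend b).restrict h = c := by
  refine Prod.ext rfl (funext fun i => ?_)
  change Fin.append c.2 b (Fin.castAdd k i) = _
  rw [Fin.append_left]

theorem extend_bijective (q N k : ℕ) :
    Function.Bijective fun p : Cyl q N × (Fin k → Fin 2) => p.1.extend p.2 := by
  constructor
  · rintro ⟨⟨i, c⟩, b⟩ ⟨⟨i', c'⟩, b'⟩ h
    simp only [Cyl.extend, Prod.mk.injEq] at h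
    have := (Fin.appendEquiv N k).injective (a₁ := (c, b)) (a₂ := (c', b')) h.2
    simp_all
  · rintro ⟨i, c⟩
    obtain ⟨⟨a, b⟩, h⟩ := (Fin.appendEquiv (α := Fin 2) N k).surjective c
    exact ⟨((i, a), b), Prod.ext rfl h⟩

theorem extend_inj {q N k : ℕ} {c c' : Cyl q N} {b b' : Fin k → Fin 2} :
    c.extend b = c'.extend b' ↔ c = c' ∧ b = b' := by
  rw [← Prod.mk.injEq]
  exact (extend_bijective q N k).injective.eq_iff (a := (c, b)) (b := (c', b'))

theorem continuous_trunc {q : ℕ} (N : ℕ) : Continuous (trunc (q := q) N) := by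
  unfold trunc; fun_prop

theorem measurableSet_trunc_preimage {q N : ℕ} (A : Set (Cyl q N)) :
    MeasurableSet (trunc N ⁻¹' A) :=
  ((isOpen_discrete A).preimage (continuous_trunc N)).measurableSet

theorem cantorMeasure_cylinder (q : ℕ) (r : ℝ) {N : ℕ} (c : Cyl q N) :
    cantorMeasure q r (trunc N ⁻¹' {c}) = ENNReal.ofReal (r / q) * 2⁻¹ ^ N := by
  let t : ℕ → Set (Fin 2) := fun i => if h : i < N then {c.2 ⟨i, h⟩} else Set.univ
  have h1 : trunc N ⁻¹' {c} = {c.1} ×ˢ ((Finset.range N : Set ℕ).pi t) := by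
    ext x
    simp only [Set.mem_preimage, Set.mem_singleton_iff, trunc, Prod.ext_iff, Set.mem_prod,
      Set.mem_pi, Finset.coe_range, Set.mem_Iio, t, funext_iff, Fin.forall_iff]
    refine and_congr Iff.rfl (forall_congr' fun i => forall_congr' fun hi => ?_)
    simp [hi]
  have h2 : ∀ i ∈ Finset.range N, coinMeasure (t i) = 2⁻¹ := by
    intro i hi
    simp [t, Finset.mem_range.1 hi, coinMeasure]
  rw [h1, cantorMeasure, Measure.prod_prod, Measure.infinitePi_pi _ fun i _ =>
    (Set.toFinite _).measurableSet, Finset.prod_congr rfl h2]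
  simp

instance isFiniteMeasure_cantorMeasure (q : ℕ) (r : ℝ) : IsFiniteMeasure (cantorMeasure q r) := by
  have : IsFiniteMeasure (ENNReal.ofReal (r / q) • (Measure.count : Measure (Fin q))) :=
    Measure.smul_finite _ ENNReal.ofReal_ne_top
  unfold cantorMeasure
  infer_instance

theorem cantorMeasure_real_cylinder (q : ℕ) {r : ℝ} (hr : 0 ≤ r) {N : ℕ} (c : Cyl q N) :
    (cantorMeasure q r).real (trunc N ⁻¹' {c}) = r / q / 2 ^ N := by
  rw [Measure.real, cantorMeasure_cylinder, ENNReal.toReal_mul,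
    ENNReal.toReal_ofReal (by positivity), ENNReal.toReal_pow, ENNReal.toReal_inv]
  simp [div_eq_mul_inv]

/-! ### Averages over cylinders -/

section Averages

theorem integrable_cantorMeasure {V : Type*} [NormedAddCommGroup V] {q : ℕ} (r : ℝ)
    (f : C(CantorSpace q, V)) : Integrable f (cantorMeasure q r) :=
  f.continuous.integrable_of_hasCompactSupport (HasCompactSupport.of_compactSpace _)

variable {V : Type*} [NormedAddCommGroup V] [NormedSpace ℝ V] {q : ℕ}

/-- The average of `f` over the cylinder `c`, with respect to `cantorMeasure q r`. -/
noncomputable def cylAvg (r : ℝ) (f : C(CantorSpace q, V)) (N : ℕ) (c : Cyl q N) : V :=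
  ((2 : ℝ) ^ N / (r / q)) • ∫ x in trunc N ⁻¹' {c}, f x ∂(cantorMeasure q r)

theorem norm_cylAvg_sub_le [NeZero q] [CompleteSpace V] {r : ℝ} (hr : 0 < r)
    (f : C(CantorSpace q, V)) {N : ℕ} (c : Cyl q N) (v : V) {D : ℝ}
    (hD : ∀ x, trunc N x = c → ‖f x - v‖ ≤ D) : ‖cylAvg r f N c - v‖ ≤ D := by
  have hq : (0 : ℝ) < q := by exact_mod_cast NeZero.pos q
  have hμ := cantorMeasure_real_cylinder q hr.le c
  have h1 : ‖∫ x in trunc N ⁻¹' {c}, (f x - v) ∂(cantorMeasure q r)‖ ≤ D * (r / q / 2 ^ N) := by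
    rw [← hμ]
    exact norm_setIntegral_le_of_norm_le_const (measure_lt_top _ _) fun x hx => hD x hx
  have h2 : cylAvg r f N c - v =
      ((2 : ℝ) ^ N / (r / q)) • ∫ x in trunc N ⁻¹' {c}, (f x - v) ∂(cantorMeasure q r) := by
    rw [integral_sub (integrable_cantorMeasure r f).integrableOn (integrable_const v),
      setIntegral_const, hμ, smul_sub, smul_smul, cylAvg]
    congr 1
    have : (2 : ℝ) ^ N / (r / q) * (r / q / 2 ^ N) = 1 := by field_simp
    rw [this, one_smul]
  rw [h2, norm_smul, Real.norm_of_nonneg (by positivity)]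
  calc _ ≤ (2 : ℝ) ^ N / (r / q) * (D * (r / q / 2 ^ N)) := by gcongr
    _ = D := by field_simp

theorem sum_cylAvg_extend (r : ℝ) (f : C(CantorSpace q, V)) {N : ℕ} (k : ℕ)
    (c : Cyl q N) : ∑ b, cylAvg r f (N + k) (c.extend b) = (2 : ℝ) ^ k • cylAvg r f N c := by
  have h1 : trunc N ⁻¹' {c} = ⋃ b : Fin k → Fin 2, trunc (N + k) ⁻¹' {c.extend b} := by
    ext x
    simp only [Set.mem_preimage, Set.mem_singleton_iff, Set.mem_iUnion]
    constructor
    · rintro rfl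
      obtain ⟨⟨c, b⟩, h⟩ := (extend_bijective q N k).surjective (trunc (N + k) x)
      refine ⟨b, ?_⟩
      rw [← h, ← restrict_trunc (Nat.le_add_right N k), ← h, restrict_extend]
    · rintro ⟨b, hb⟩
      rw [← restrict_trunc (Nat.le_add_right N k), hb, restrict_extend]
  have h2 : Pairwise (Function.onFun Disjoint
      fun b : Fin k → Fin 2 => trunc (N + k) ⁻¹' {c.extend b}) := by
    intro b b' hb
    refine Disjoint.preimage _ (Set.disjoint_singleton.2 fun h => hb (extend_inj.1 h).2)
  rw [cylAvg, h1, integral_iUnion_fintype (fun _ => measurableSet_trunc_preimage _) h2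
    (fun _ => (integrable_cantorMeasure r f).integrableOn), smul_smul, Finset.smul_sum]
  refine Finset.sum_congr rfl fun b _ => ?_
  rw [cylAvg, pow_add]
  congr 1
  ring

theorem sum_cylAvg (r : ℝ) (f : C(CantorSpace q, V)) (N : ℕ) :
    ∑ c, cylAvg r f N c = ((2 : ℝ) ^ N / (r / q)) • ∫ x, f x ∂(cantorMeasure q r) := by
  have h1 : (Set.univ : Set (CantorSpace q)) = ⋃ c : Cyl q N, trunc N ⁻¹' {c} := by
    ext x; simp
  have h2 : Pairwise (Function.onFun Disjoint
      fun c : Cyl q N => (trunc N ⁻¹' {c} : Set (CantorSpace q))) := by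
    intro b b' hb
    exact Disjoint.preimage _ (Set.disjoint_singleton.2 hb)
  rw [← setIntegral_univ, h1, integral_iUnion_fintype (fun _ => measurableSet_trunc_preimage _) h2
    (fun _ => (integrable_cantorMeasure r f).integrableOn), Finset.smul_sum]
  rfl

end Averages

/-! ### Inverse limits of permutations of cylinders -/

section InverseLimit

variable {q : ℕ} {N : ℕ → ℕ} (hN : StrictMono N)

/-- The self-map of the Cantor space induced by maps `τ m` of the cylinders of level `N m`; it is
meaningful if these maps are compatible with restriction. The coordinate `n` of the image is read
off at level `N (n + 1)`, which is larger than `n`. -/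
def limitMap (τ : ∀ m, Cyl q (N m) → Cyl q (N m)) (x : CantorSpace q) : CantorSpace q :=
  ((τ 0 (trunc (N 0) x)).1,
    fun n => (τ (n + 1) (trunc (N (n + 1)) x)).2 ⟨n, hN.id_le (n + 1)⟩)

theorem continuous_limitMap (τ : ∀ m, Cyl q (N m) → Cyl q (N m)) :
    Continuous (limitMap hN τ) := by
  unfold limitMap
  refine Continuous.prodMk ?_ (continuous_pi fun n => ?_)
  · exact (continuous_of_discreteTopology (f := fun c => (τ 0 c).1)).comp (continuous_trunc _)
  · exact (continuous_of_discreteTopology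
      (f := fun c => (τ (n + 1) c).2 ⟨n, hN.id_le (n + 1)⟩)).comp (continuous_trunc _)

theorem trunc_limitMap {τ : ∀ m, Cyl q (N m) → Cyl q (N m)}
    (hτ : ∀ m c, (τ (m + 1) c).restrict (hN.monotone m.le_succ) =
      τ m (c.restrict (hN.monotone m.le_succ))) (m : ℕ) (x : CantorSpace q) :
    trunc (N m) (limitMap hN τ x) = τ m (trunc (N m) x) := by
  have hle : ∀ m m' (h : m ≤ m') x,
      (τ m' (trunc (N m') x)).restrict (hN.monotone h) = τ m (trunc (N m) x) := by
    intro m m' h x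
    induction m', h using Nat.le_induction with
    | base => rfl
    | succ m' h ih => rw [← ih, ← restrict_trunc (hN.monotone m'.le_succ), ← hτ]; rfl
  have hcoord : ∀ m m' n (h : n < N m) (h' : n < N m') x,
      (τ m (trunc (N m) x)).2 ⟨n, h⟩ = (τ m' (trunc (N m') x)).2 ⟨n, h'⟩ := by
    intro m m' n h h' x
    rcases le_total m m' with hm | hm
    · rw [← hle m m' hm]; rfl
    · rw [← hle m' m hm]; rfl
  refine Prod.ext ?_ (funext fun n => ?_)
  · change (τ 0 (trunc (N 0) x)).1 = (τ m (trunc (N m) x)).1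
    rw [← hle 0 m (Nat.zero_le _)]; rfl
  · exact hcoord _ _ _ _ _ _

theorem eq_of_forall_trunc_eq {x y : CantorSpace q} (hN : StrictMono N)
    (h : ∀ m, trunc (N m) x = trunc (N m) y) : x = y := by
  refine Prod.ext (congrArg Prod.fst (h 0) :) (funext fun n => ?_)
  exact congrFun (congrArg Prod.snd (h (n + 1))) ⟨n, hN.id_le (n + 1)⟩

theorem measurePreserving_of_trunc {r : ℝ} {τ : ∀ m, Equiv.Perm (Cyl q (N m))}
    (hN : StrictMono N) {T : CantorSpace q → CantorSpace q} (hT : Continuous T)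
    (h : ∀ m x, trunc (N m) (T x) = τ m (trunc (N m) x)) :
    MeasurePreserving T (cantorMeasure q r) (cantorMeasure q r) := by
  classical
  refine ⟨hT.measurable, ?_⟩
  let C : Set (Set (CantorSpace q)) := {s | ∃ m, ∃ A : Set (Cyl q (N m)), s = trunc (N m) ⁻¹' A}
  have hmono : ∀ m m', m ≤ m' → ∀ A : Set (Cyl q (N m)), ∃ B : Set (Cyl q (N m')),
      trunc (N m) ⁻¹' A = trunc (N m') ⁻¹' B := fun m m' hm A =>
    ⟨Cyl.restrict (hN.monotone hm) ⁻¹' A, rfl⟩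
  have hC : IsPiSystem C := by
    rintro _ ⟨m, A, rfl⟩ _ ⟨m', B, rfl⟩ -
    obtain ⟨A', hA'⟩ := hmono m (max m m') (le_max_left _ _) A
    obtain ⟨B', hB'⟩ := hmono m' (max m m') (le_max_right _ _) B
    exact ⟨max m m', A' ∩ B', by rw [hA', hB', Set.preimage_inter]⟩
  have hgen : (inferInstance : MeasurableSpace (CantorSpace q)) =
      MeasurableSpace.generateFrom C := by
    apply le_antisymm
    · have : @Measurable _ _ (MeasurableSpace.generateFrom C) _
          (id : CantorSpace q → CantorSpace q) := by
        refine @Measurable.prod _ _ _ (MeasurableSpace.generateFrom C) _ _ id ?_ ?_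
        · intro A _
          exact MeasurableSpace.measurableSet_generateFrom ⟨0, {c | c.1 ∈ A}, rfl⟩
        · refine @measurable_pi_lambda _ _ _ (MeasurableSpace.generateFrom C) _ _ fun n => ?_
          intro A _
          exact MeasurableSpace.measurableSet_generateFrom
            ⟨n + 1, {c | c.2 ⟨n, hN.id_le (n + 1)⟩ ∈ A}, rfl⟩
      simpa using this.comap_le
    · refine MeasurableSpace.generateFrom_le ?_
      rintro _ ⟨m, A, rfl⟩
      exact measurableSet_trunc_preimage A
  have hcard : ∀ m (A : Finset (Cyl q (N m))), cantorMeasure q r (trunc (N m) ⁻¹' A) =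
      A.card * (ENNReal.ofReal (r / q) * 2⁻¹ ^ (N m)) := by
    intro m A
    rw [← sum_measure_preimage_singleton A fun _ _ => measurableSet_trunc_preimage _,
      Finset.sum_congr rfl fun c _ => cantorMeasure_cylinder q r c, Finset.sum_const, nsmul_eq_mul]
  refine ext_of_generate_finite C hgen hC ?_ ?_
  · rintro _ ⟨m, A, rfl⟩
    rw [Measure.map_apply hT.measurable (measurableSet_trunc_preimage A)]
    have h1 : T ⁻¹' (trunc (N m) ⁻¹' A) = trunc (N m) ⁻¹' ((τ m) ⁻¹' A) := by
      ext x; simp [h]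
    have h2 : (A.toFinset.map (τ m).symm.toEmbedding : Set (Cyl q (N m))) = (τ m) ⁻¹' A := by
      ext c; simp
    have h3 : (A.toFinset : Set (Cyl q (N m))) = A := by simp
    rw [h1, ← h2, hcard, Finset.card_map, ← hcard, h3]
  · rw [Measure.map_apply hT.measurable MeasurableSet.univ, Set.preimage_univ]

end InverseLimit

/-! ### Cyclic enumerations and their prefix sums -/

/-- `e` runs through all elements of `α` periodically, meeting each one exactly once in every
period of length `L`. -/
structure IsCyclicEnum {α : Type*} (L : ℕ) (e : ℕ → α) : Prop where
  eq_iff : ∀ i j, e i = e j ↔ i ≡ j [MOD L]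
  surjective : Function.Surjective e

namespace IsCyclicEnum

variable {α : Type*} {L : ℕ} {e : ℕ → α}

/-- The map moving each element `k` steps ahead along the enumeration. -/
noncomputable def shift (h : IsCyclicEnum L e) (k : ℕ) (c : α) : α :=
  e (Function.surjInv h.surjective c + k)

theorem shift_apply (h : IsCyclicEnum L e) (k i : ℕ) : h.shift k (e i) = e (i + k) := by
  rw [shift, h.eq_iff]
  exact Nat.ModEq.add_right k ((h.eq_iff _ _).1 (Function.surjInv_eq _ _))

/-- The cyclic permutation moving each element to the next one of the enumeration. -/
noncomputable def next (h : IsCyclicEnum L e) (hL : 0 < L) : Equiv.Perm α where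
  toFun := h.shift 1
  invFun := h.shift (L - 1)
  left_inv c := by
    obtain ⟨i, rfl⟩ := h.surjective c
    rw [h.shift_apply, h.shift_apply, h.eq_iff, add_assoc, Nat.add_sub_cancel' hL]
    simp [Nat.ModEq]
  right_inv c := by
    obtain ⟨i, rfl⟩ := h.surjective c
    rw [h.shift_apply, h.shift_apply, h.eq_iff, add_assoc, Nat.sub_add_cancel hL]
    simp [Nat.ModEq]

theorem next_apply (h : IsCyclicEnum L e) (hL : 0 < L) (i : ℕ) : h.next hL (e i) = e (i + 1) :=
  h.shift_apply 1 i

theorem sum_range {M : Type*} [AddCommMonoid M] [Fintype α] (h : IsCyclicEnum L e) (hL : 0 < L)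
    (F : α → M) : ∑ i ∈ Finset.range L, F (e i) = ∑ c, F c := by
  refine Finset.sum_nbij e (by simp) (fun i hi j hj hij => ?_) (fun c _ => ?_) (by simp)
  · simp only [Finset.coe_range, Set.mem_Iio] at hi hj
    exact Nat.ModEq.eq_of_lt_of_lt ((h.eq_iff i j).1 hij) hi hj
  · obtain ⟨i, rfl⟩ := h.surjective c
    refine ⟨i % L, by simpa using Nat.mod_lt i hL, ?_⟩
    rw [h.eq_iff]
    exact Nat.mod_modEq i L

/-- The sum of `F` over the elements enumerated before `c`. -/
noncomputable def prefixSum {M : Type*} [AddCommMonoid M] (h : IsCyclicEnum L e) (F : α → M)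
    (c : α) : M :=
  ∑ i ∈ Finset.range (Function.surjInv h.surjective c), F (e i)

theorem prefixSum_apply {M : Type*} [AddCommMonoid M] [Fintype α] (h : IsCyclicEnum L e)
    (hL : 0 < L) {F : α → M} (hF : ∑ c, F c = 0) (j : ℕ) :
    h.prefixSum F (e j) = ∑ i ∈ Finset.range j, F (e i) := by
  have hmod : ∀ n, ∑ i ∈ Finset.range n, F (e i) = ∑ i ∈ Finset.range (n % L), F (e i) := by
    intro n
    have h1 : ∀ t b, e (t * L + b) = e b := fun t b => by
      rw [h.eq_iff]
      simp [Nat.ModEq]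
    conv_lhs => rw [← Nat.div_add_mod' n L, Finset.sum_range_add, sum_range_mul_eq]
    simp only [h1, h.sum_range hL, hF, Finset.sum_const_zero, zero_add]
  have h2 : Function.surjInv h.surjective (e j) % L = j % L :=
    (h.eq_iff _ _).1 (Function.surjInv_eq _ _)
  rw [prefixSum, hmod, h2, ← hmod]

theorem prefixSum_next_sub {M : Type*} [AddCommGroup M] [Fintype α] (h : IsCyclicEnum L e)
    (hL : 0 < L) {F : α → M} (hF : ∑ c, F c = 0) (c : α) :
    h.prefixSum F (h.next hL c) - h.prefixSum F c = F c := by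
  obtain ⟨i, rfl⟩ := h.surjective c
  rw [h.next_apply, h.prefixSum_apply hL hF, h.prefixSum_apply hL hF, Finset.sum_range_succ,
    add_sub_cancel_left]

theorem exists_lt (h : IsCyclicEnum L e) (hL : 0 < L) (c : α) : ∃ i < L, e i = c := by
  obtain ⟨i, rfl⟩ := h.surjective c
  exact ⟨i % L, Nat.mod_lt i hL, (h.eq_iff _ _).2 (Nat.mod_modEq i L)⟩

end IsCyclicEnum

/-! ### Enumerations of the cylinders -/

section Enumerations

variable {V : Type*} [NormedAddCommGroup V] [NormedSpace ℝ V] [FiniteDimensional ℝ V]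
  [Nontrivial V] {q : ℕ} [NeZero q] {r : ℝ}

/-- A Steinitz ordering of the averages of `f` over the first-level cylinders. -/
theorem exists_enum_zero (hr : 0 < r) (f : C(CantorSpace q, V))
    (hmean : ∫ x, f x ∂(cantorMeasure q r) = 0) {N : ℕ} (hN : N = 0) :
    ∃ (π : Equiv.Perm (Fin q)) (e : ℕ → Cyl q N), IsCyclicEnum (q * 2 ^ N) e ∧
      (∀ i, (e i).1 = π (Fin.ofNat q i)) ∧
      ∀ n < q * 2 ^ N, ‖∑ i ∈ Finset.range n, cylAvg r f N (e i)‖ ≤ steinitzConst V * ‖f‖ := by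
  subst hN
  have : CompleteSpace V := FiniteDimensional.complete ℝ V
  let ι : Fin q ≃ Cyl q 0 := (Equiv.prodUnique (Fin q) (Fin 0 → Fin 2)).symm
  obtain ⟨π, hπ⟩ := exists_perm_prefix_le (fun i : Fin q => cylAvg r f 0 (ι i))
    (by rw [ι.sum_comp (cylAvg r f 0), sum_cylAvg, hmean, smul_zero]) (norm_nonneg f) fun i => by
      simpa using norm_cylAvg_sub_le hr f (ι i) 0 fun x _ => by simpa using f.norm_coe_le_norm x
  refine ⟨π, fun i => ι (π (Fin.ofNat q i)), ⟨fun i j => ?_, fun c => ?_⟩, fun i => rfl,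
    fun n hn => ?_⟩
  · simp [Nat.ModEq, Fin.ext_iff]
  · obtain ⟨i, rfl⟩ := ι.surjective c
    exact ⟨π.symm i, by simp⟩
  · exact hπ n (by simpa using hn.le) (fun i => cylAvg r f 0 (ι (π (Fin.ofNat q i))))
      fun i => by simp

/-- A cyclic enumeration of the cylinders of level `N` is refined by one at level `M`, such that the
prefix sums of the averages of `f` change only by a multiple of the oscillation of `f` at
level `N`. The row `i` of `exists_row_orders` consists of the subcylinders of the `i`th cylinder. -/
theorem exists_enum_refine (hr : 0 < r) (f : C(CantorSpace q, V)) {N M : ℕ} (hNM : N ≤ M)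
    {e : ℕ → Cyl q N} (he : IsCyclicEnum (q * 2 ^ N) e) {D : ℝ} (hD0 : 0 ≤ D)
    (hD : ∀ x y, trunc N x = trunc N y → ‖f x - f y‖ ≤ D) :
    ∃ e' : ℕ → Cyl q M, IsCyclicEnum (q * 2 ^ M) e' ∧ (∀ i, (e' i).restrict hNM = e i) ∧
      ∀ n < q * 2 ^ M, ‖∑ i ∈ Finset.range n, (cylAvg r f M (e' i) - cylAvg r f N (e i))‖
        ≤ (steinitzConst V + 1) * (2 * Module.finrank ℝ V * D) := by
  have : CompleteSpace V := FiniteDimensional.complete ℝ V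
  obtain ⟨k, rfl⟩ := Nat.exists_eq_add_of_le hNM
  set L := q * 2 ^ N with hL
  have hL0 : 0 < L := Nat.mul_pos (NeZero.pos q) (by positivity)
  have hLk : q * 2 ^ (N + k) = L * 2 ^ k := by rw [hL, pow_add, mul_assoc]
  let w : ℕ → (Fin k → Fin 2) → V := fun i b =>
    cylAvg r f (N + k) ((e i).extend b) - cylAvg r f N (e i)
  have hext : ∀ (c : Cyl q N) b x, trunc (N + k) x = c.extend b → trunc N x = c :=
    fun c b x hx => by
      rw [← restrict_trunc (Nat.le_add_right N k), hx, restrict_extend]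
  have hw : ∀ i b b', ‖w i b - w i b'‖ ≤ D := by
    intro i b b'
    simp only [w, sub_sub_sub_cancel_right]
    refine norm_cylAvg_sub_le hr f _ _ fun x hx => ?_
    rw [norm_sub_rev]
    refine norm_cylAvg_sub_le hr f _ _ fun y hy => hD _ _ ?_
    rw [hext _ _ _ hx, hext _ _ _ hy]
  have hw0 : ∀ i, ∑ b, w i b = 0 := by
    intro i
    simp only [w]
    rw [Finset.sum_sub_distrib, sum_cylAvg_extend, Finset.sum_const, Finset.card_univ,
      Fintype.card_pi_const, Fintype.card_fin, ← Nat.cast_smul_eq_nsmul ℝ, Nat.cast_pow,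
      Nat.cast_ofNat, sub_self]
  obtain ⟨σ, hσ1, hσ2, hσ3⟩ := exists_row_orders hD0 hL0 k (by simp) w hw hw0
  have hemod : ∀ i, e (i % L) = e i := fun i => (he.eq_iff _ _).2 (Nat.mod_modEq i L)
  rw [hLk]
  refine ⟨fun i => (e i).extend (σ (i % L) (i / L)), ⟨fun i j => ?_, fun c => ?_⟩,
    fun i => restrict_extend hNM _ _, fun n hn => ?_⟩
  · rw [extend_inj, he.eq_iff]
    unfold Nat.ModEq
    have hmul : ∀ i, i % (L * 2 ^ k) = i % L + L * (i / L % 2 ^ k) := fun i => Nat.mod_mul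
    rw [hmul i, hmul j]
    constructor
    · rintro ⟨h1, h2⟩
      rw [h1, hσ1] at h2
      rw [h1, h2]
    · intro h
      have h1 : i % L = j % L := by
        have := congrArg (· % L) h
        simpa using this
      refine ⟨h1, ?_⟩
      rw [h1] at h ⊢
      rw [hσ1]
      exact Nat.eq_of_mul_eq_mul_left hL0 (Nat.add_left_cancel h)
  · obtain ⟨⟨c, b⟩, rfl⟩ := (extend_bijective q N k).surjective c
    obtain ⟨i, hi, rfl⟩ := he.exists_lt hL0 c
    obtain ⟨t, rfl⟩ := hσ2 i b
    have h1 : (t * L + i) % L = i := by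
      rw [mul_comm, Nat.mul_add_mod, Nat.mod_eq_of_lt hi]
    have h2 : (t * L + i) / L = t := by
      rw [mul_comm, Nat.mul_add_div hL0, Nat.div_eq_of_lt hi, add_zero]
    exact ⟨t * L + i, by simp only [h1, h2]; rw [← hemod, h1]⟩
  · refine le_of_eq_of_le ?_ (hσ3 n hn)
    simp only [w, hemod]

end Enumerations

/-! ### Oscillation on cylinders -/

theorem norm_sub_le_iSup_diam {V : Type*} [NormedAddCommGroup V] {q : ℕ}
    (f : C(CantorSpace q, V)) {x y : CantorSpace q} (h : x.1 = y.1) :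
    ‖f x - f y‖ ≤ ⨆ i : Fin q, Metric.diam (f '' firstCylinder q i) := by
  rw [← dist_eq_norm]
  have hb : Bornology.IsBounded (f '' firstCylinder q y.1) :=
    (isCompact_range f.continuous).isBounded.subset (Set.image_subset_range _ _)
  exact (Metric.dist_le_diam_of_mem hb ⟨x, h, rfl⟩ ⟨y, rfl, rfl⟩).trans
    (le_ciSup (f := fun i : Fin q => Metric.diam (f '' firstCylinder q i))
      (Set.finite_range _).bddAbove y.1)

/-- Uniform continuity, in terms of cylinders. -/
theorem exists_trunc_norm_sub_lt {V : Type*} [NormedAddCommGroup V] {q : ℕ}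
    (f : C(CantorSpace q, V)) {ε : ℝ} (hε : 0 < ε) :
    ∃ N, ∀ x y, trunc N x = trunc N y → ‖f x - f y‖ < ε := by
  by_contra! hcon
  let K : ℕ → Set (CantorSpace q × CantorSpace q) := fun N =>
    {p | trunc N p.1 = trunc N p.2} ∩ {p | ε ≤ ‖f p.1 - f p.2‖}
  have hK : ∀ N, IsClosed (K N) := fun N =>
    (isClosed_eq ((continuous_trunc N).comp continuous_fst)
      ((continuous_trunc N).comp continuous_snd)).inter
    (isClosed_le continuous_const (by fun_prop))
  obtain ⟨p, hp⟩ := IsCompact.nonempty_iInter_of_sequence_nonempty_isCompact_isClosed K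
    (fun N p hp => ⟨by
      have h1 : trunc (N + 1) p.1 = trunc (N + 1) p.2 := hp.1
      change trunc N p.1 = trunc N p.2
      rw [← restrict_trunc N.le_succ, h1, restrict_trunc], hp.2⟩)
    (fun N => by
      obtain ⟨x, y, h1, h2⟩ := hcon N
      exact ⟨(x, y), h1, h2⟩) (hK 0).isCompact hK
  rw [Set.mem_iInter] at hp
  have h1 : p.1 = p.2 := eq_of_forall_trunc_eq strictMono_id fun m => (hp m).1
  have h2 : ε ≤ ‖f p.1 - f p.2‖ := (hp 0).2
  rw [h1, sub_self, norm_zero] at h2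
  linarith

/-- Levels, starting with `0`, at which the oscillation of `f` on cylinders is at least halved each
time. -/
theorem exists_levels {V : Type*} [NormedAddCommGroup V] {q : ℕ} (f : C(CantorSpace q, V)) {D : ℝ}
    (hD : ∀ x y : CantorSpace q, x.1 = y.1 → ‖f x - f y‖ ≤ D) :
    ∃ N : ℕ → ℕ, StrictMono N ∧ N 0 = 0 ∧
      ∀ m x y, trunc (N m) x = trunc (N m) y → ‖f x - f y‖ ≤ D / 2 ^ m := by
  have h1 : ∀ m, ∃ N, ∀ x y, trunc N x = trunc N y → ‖f x - f y‖ ≤ D / 2 ^ m := by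
    intro m
    rcases lt_or_ge 0 D with h | h
    · obtain ⟨N, hN⟩ := exists_trunc_norm_sub_lt f (ε := D / 2 ^ m) (by positivity)
      exact ⟨N, fun x y hxy => (hN x y hxy).le⟩
    · -- Then `f` is constant on the first-level cylinders.
      refine ⟨0, fun x y hxy => ?_⟩
      have h2 := hD x y (congrArg Prod.fst hxy :)
      have h3 : D = 0 := le_antisymm h ((norm_nonneg _).trans h2)
      simpa [h3] using h2
  choose N hN using h1
  refine ⟨fun m => ∑ i ∈ Finset.range m, (N (i + 1) + 1), ?_, by simp, fun m x y hxy => ?_⟩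
  · refine strictMono_nat_of_lt_succ fun m => ?_
    rw [Finset.sum_range_succ]
    omega
  · cases m with
    | zero => simpa using hD x y (congrArg Prod.fst hxy :)
    | succ m =>
      have h2 : N (m + 1) ≤ ∑ i ∈ Finset.range (m + 1), (N (i + 1) + 1) := by
        rw [Finset.sum_range_succ]
        omega
      exact hN _ x y (by rw [← restrict_trunc h2, hxy, restrict_trunc])

theorem le_kwapienConst {V : Type*} [NormedAddCommGroup V] [NormedSpace ℝ V]
    [FiniteDimensional ℝ V] [Nontrivial V] :
    (steinitzConst V + 1) * (4 * Module.finrank ℝ V) ≤ kwapienConst V := by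
  have hS := one_le_of_mem_steinitzSet (steinitzConst_mem V)
  have hd : (1 : ℝ) ≤ Module.finrank ℝ V := by exact_mod_cast Module.finrank_pos (R := ℝ) (M := V)
  have h1 : Real.log 1.5 ≤ 1 := (Real.log_le_sub_one_of_pos (by norm_num)).trans (by norm_num)
  have h0 : 0 < Real.log 1.5 := Real.log_pos (by norm_num)
  rw [kwapienConst, mul_comm]
  gcongr
  rw [le_div_iff₀ h0]
  nlinarith

/-! ### The coboundary -/

theorem theorem6p1 (V : Type*) [NormedAddCommGroup V] [NormedSpace ℝ V] [FiniteDimensional ℝ V]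
    (q : ℕ) [NeZero q] (r : ℝ) (hr : 0 < r)
    (f : C(CantorSpace q, V)) (hf : f ≠ 0) (hmean : ∫ x, f x ∂(cantorMeasure q r) = 0) :
    ∃ (g : C(CantorSpace q, V)) (T : CantorSpace q ≃ₜ CantorSpace q),
      MeasurePreserving T (cantorMeasure q r) (cantorMeasure q r) ∧
      (∀ x, f x = g (T x) - g x) ∧
      ‖g‖ ≤ (steinitzConst V + relOscillation f * (1 + kwapienConst V)) * ‖f‖ ∧
      -- a labelling `X j = firstCylinder q (σ j)`, with cyclic addition `j + 1` in `Fin q`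
      ∃ σ : Equiv.Perm (Fin q),
        (∀ j : Fin q, T '' firstCylinder q (σ j) = firstCylinder q (σ (j + 1))) ∧
        ∀ x ∈ firstCylinder q (σ 0), ‖g x‖ ≤ (1 + kwapienConst V) * relOscillation f * ‖f‖ := by
  have : CompleteSpace V := FiniteDimensional.complete ℝ V
  have : Nontrivial V := by
    obtain ⟨x, hx⟩ := DFunLike.ne_iff.1 hf
    exact ⟨⟨f x, 0, by simpa using hx⟩⟩
  have hS := one_le_of_mem_steinitzSet (steinitzConst_mem V)
  set S := steinitzConst V
  set D : ℝ := ⨆ i : Fin q, Metric.diam (f '' firstCylinder q i) with hDdef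
  have hD0 : 0 ≤ D := Real.iSup_nonneg fun _ => Metric.diam_nonneg
  have hDosc : relOscillation f * ‖f‖ = D :=
    div_mul_cancel₀ _ (norm_ne_zero_iff.2 hf)
  obtain ⟨N, hN, hN0, hosc⟩ := exists_levels f (D := D) fun x y h => norm_sub_le_iSup_diam f h
  have hL : ∀ m, 0 < q * 2 ^ N m := fun m => Nat.mul_pos (NeZero.pos q) (by positivity)
  -- Enumerations `E m` of the cylinders of level `N m`, each one refining the previous one.
  obtain ⟨π, e₀, he₀, hπ, hbound₀⟩ := exists_enum_zero hr f hmean hN0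
  have hstep : ∀ m (e : {e : ℕ → Cyl q (N m) // IsCyclicEnum (q * 2 ^ N m) e}), ∃ e' :
      {e : ℕ → Cyl q (N (m + 1)) // IsCyclicEnum (q * 2 ^ N (m + 1)) e},
      (∀ i, (e'.1 i).restrict (hN.monotone m.le_succ) = e.1 i) ∧
      ∀ n < q * 2 ^ N (m + 1), ‖∑ i ∈ Finset.range n,
        (cylAvg r f (N (m + 1)) (e'.1 i) - cylAvg r f (N m) (e.1 i))‖
        ≤ (S + 1) * (2 * Module.finrank ℝ V * (D / 2 ^ m)) := fun m e => by
    obtain ⟨e', h1, h2⟩ := exists_enum_refine hr f (hN.monotone m.le_succ) e.2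
      (D := D / 2 ^ m) (by positivity) (hosc m)
    exact ⟨⟨e', h1⟩, h2⟩
  choose step hstep using hstep
  let E : ∀ m, {e : ℕ → Cyl q (N m) // IsCyclicEnum (q * 2 ^ N m) e} :=
    fun m => Nat.rec ⟨e₀, he₀⟩ step m
  let τ : ∀ m, Equiv.Perm (Cyl q (N m)) := fun m => (E m).2.next (hL m)
  let F : ∀ m, Cyl q (N m) → V := fun m => cylAvg r f (N m)
  have hF : ∀ m, ∑ c, F m c = 0 := fun m => by
    simp only [F]
    rw [sum_cylAvg, hmean, smul_zero]
  let G : ∀ m, Cyl q (N m) → V := fun m => (E m).2.prefixSum (F m)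
  have hτ : ∀ m c, (τ (m + 1) c).restrict (hN.monotone m.le_succ) =
      τ m (c.restrict (hN.monotone m.le_succ)) := by
    intro m c
    obtain ⟨i, rfl⟩ := (E (m + 1)).2.surjective c
    have h1 : ∀ i, ((E (m + 1)).1 i).restrict (hN.monotone m.le_succ) = (E m).1 i :=
      (hstep m (E m)).1
    simp only [τ]
    rw [(E (m + 1)).2.next_apply, h1, h1, (E m).2.next_apply]
  have hτ' : ∀ m c, ((τ (m + 1)).symm c).restrict (hN.monotone m.le_succ) =
      (τ m).symm (c.restrict (hN.monotone m.le_succ)) := by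
    intro m c
    rw [Equiv.eq_symm_apply, ← hτ, Equiv.apply_symm_apply]
  -- The homeomorphism `T`.
  have hT := trunc_limitMap hN (τ := fun m => τ m) hτ
  have hT' := trunc_limitMap hN (τ := fun m => (τ m).symm) hτ'
  let T : CantorSpace q ≃ₜ CantorSpace q :=
    { toFun := limitMap hN fun m => τ m
      invFun := limitMap hN fun m => (τ m).symm
      left_inv := fun x => eq_of_forall_trunc_eq hN fun m => by simp [hT', hT]
      right_inv := fun x => eq_of_forall_trunc_eq hN fun m => by simp [hT', hT]
      continuous_toFun := continuous_limitMap hN _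
      continuous_invFun := continuous_limitMap hN _ }
  have hT : ∀ m x, trunc (N m) (T x) = τ m (trunc (N m) x) := hT
  -- The function `g` is the uniform limit of the prefix sums.
  let g' : ℕ → C(CantorSpace q, V) := fun m =>
    ⟨fun x => G m (trunc (N m) x),
      (continuous_of_discreteTopology (f := G m)).comp (continuous_trunc (N m))⟩
  set K : ℝ := (S + 1) * (4 * Module.finrank ℝ V) * D with hK
  have hK0 : 0 ≤ K := by positivity
  have hdist : ∀ m, dist (g' m) (g' (m + 1)) ≤ K / 2 / 2 ^ m := by
    intro m
    rw [dist_comm, ContinuousMap.dist_le (by positivity)]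
    intro x
    rw [dist_eq_norm]
    change ‖G (m + 1) (trunc (N (m + 1)) x) - G m (trunc (N m) x)‖ ≤ _
    obtain ⟨n, hn, hx⟩ := (E (m + 1)).2.exists_lt (hL (m + 1)) (trunc (N (m + 1)) x)
    rw [← restrict_trunc (hN.monotone m.le_succ), ← hx, (hstep m (E m)).1]
    simp only [G]
    rw [(E (m + 1)).2.prefixSum_apply (hL (m + 1)) (hF (m + 1)),
      (E m).2.prefixSum_apply (hL m) (hF m), ← Finset.sum_sub_distrib]
    refine ((hstep m (E m)).2 n hn).trans (le_of_eq ?_)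
    rw [hK]
    ring
  obtain ⟨g, hg⟩ := cauchySeq_tendsto_of_complete (cauchySeq_of_le_geometric_two hdist)
  have hgx : ∀ x, Filter.Tendsto (fun m => g' m x) Filter.atTop (nhds (g x)) := fun x =>
    ((continuous_eval_const x).tendsto g).comp hg
  have hg0 : dist (g' 0) g ≤ K := dist_le_of_le_geometric_two_of_tendsto₀ hdist hg
  have hKC : K ≤ (1 + kwapienConst V) * D := by
    have := mul_le_mul_of_nonneg_right (le_kwapienConst (V := V)) hD0
    linarith
  have hcob : ∀ x, f x = g (T x) - g x := by
    intro x
    have h1 : ∀ m, g' m (T x) - g' m x = F m (trunc (N m) x) := by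
      intro m
      change G m (trunc (N m) (T x)) - G m (trunc (N m) x) = _
      rw [hT]
      exact (E m).2.prefixSum_next_sub (hL m) (hF m) _
    have h2 : Filter.Tendsto (fun m => F m (trunc (N m) x)) Filter.atTop (nhds (f x)) := by
      rw [tendsto_iff_norm_sub_tendsto_zero]
      refine squeeze_zero (fun _ => norm_nonneg _) (fun m => norm_cylAvg_sub_le hr f _ _
        fun y hy => hosc m y x hy) ?_
      have := (tendsto_pow_atTop_nhds_zero_of_lt_one (r := (1 / 2 : ℝ))
        (by norm_num) (by norm_num)).const_mul D
      simpa [div_eq_mul_inv] using this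
    simp only [← h1] at h2
    exact tendsto_nhds_unique h2 ((hgx (T x)).sub (hgx x))
  have hfst : ∀ x i, trunc (N 0) x = (E 0).1 i →
      x.1 = π (Fin.ofNat q i) ∧ (T x).1 = π (Fin.ofNat q i + 1) := by
    intro x i hx
    refine ⟨(congrArg Prod.fst hx).trans (hπ i), ?_⟩
    have h1 : trunc (N 0) (T x) = (E 0).1 (i + 1) := by
      rw [hT, hx]
      exact (E 0).2.next_apply (hL 0) i
    refine (congrArg Prod.fst h1).trans ((hπ (i + 1)).trans ?_)
    congr 1
    simp [Fin.ext_iff, Fin.val_add]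
  have hcyl : ∀ x j, x.1 = π j ↔ (T x).1 = π (j + 1) := by
    intro x j
    obtain ⟨i, hi⟩ := (E 0).2.surjective (trunc (N 0) x)
    obtain ⟨h1, h2⟩ := hfst x i hi.symm
    rw [h1, h2, π.apply_eq_iff_eq, π.apply_eq_iff_eq, add_left_inj]
  refine ⟨g, T, measurePreserving_of_trunc hN T.continuous hT, hcob, ?_, π, fun j => ?_,
    fun x hx => ?_⟩
  · have h1 : ‖g' 0‖ ≤ S * ‖f‖ := by
      rw [ContinuousMap.norm_le _ (by positivity)]
      intro x
      change ‖G 0 (trunc (N 0) x)‖ ≤ _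
      obtain ⟨n, hn, hx⟩ := (E 0).2.exists_lt (hL 0) (trunc (N 0) x)
      rw [← hx]
      simp only [G]
      rw [(E 0).2.prefixSum_apply (hL 0) (hF 0)]
      exact hbound₀ n hn
    have h2 : ‖g‖ ≤ ‖g' 0‖ + dist (g' 0) g := by
      rw [dist_eq_norm, norm_sub_rev]
      exact norm_le_norm_add_norm_sub' g (g' 0)
    have h3 : (S + relOscillation f * (1 + kwapienConst V)) * ‖f‖ =
        S * ‖f‖ + (1 + kwapienConst V) * D := by
      rw [← hDosc]; ring
    rw [h3]
    linarith
  · ext y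
    obtain ⟨x, rfl⟩ := T.surjective y
    rw [T.injective.mem_set_image]
    exact hcyl x j
  · -- The prefix sum `g' 0` vanishes on the first cylinder of the enumeration.
    have h1 : g' 0 x = 0 := by
      change G 0 (trunc (N 0) x) = 0
      obtain ⟨i, hi⟩ := (E 0).2.surjective (trunc (N 0) x)
      have h2 : Fin.ofNat q i = 0 := π.injective ((hfst x i hi.symm).1.symm.trans hx)
      have h3 : trunc (N 0) x = (E 0).1 0 := by
        rw [← hi, (E 0).2.eq_iff, hN0, pow_zero, mul_one]
        simpa [Fin.ext_iff, Nat.ModEq] using h2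
      rw [h3]
      simp only [G]
      rw [(E 0).2.prefixSum_apply (hL 0) (hF 0), Finset.range_zero, Finset.sum_empty]
    have h2 : ‖g x‖ ≤ dist (g' 0) g := by
      have := ContinuousMap.dist_apply_le_dist (f := g' 0) (g := g) x
      rwa [h1, dist_zero_left] at this
    rw [mul_assoc, hDosc]
    exact h2.trans (hg0.trans hKC)
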